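/- Let $a>0$, $\nu>0$, $\mu\le 0$ and $\Delta\le 0$. For $\ell>0$ let $\Lambda_\ell\subset\mathbb R^3$ be the cubic box of side $\ell$ and volume $V_\ell=\ell^3$, let $\Lambda_\ell^*=\{\mathbf p\in\mathbb R^3: p_\alpha\in \tfrac{2\pi}{\ell}\mathbb Z,\ \alpha=1,2,3\}$ be the set of momenta (periodic boundary conditions), let $\hat a^\dagger_{\mathbf p},\hat a_{\mathbf p}$ be the creation and annihilation operators on the boson Fock space $\mathcal F_B$ over $L^2(\Lambda_\ell)$, and put $\hat n_{\mathbf p}=\hat a^\dagger_{\mathbf p}\hat a_{\mathbf p}$ and $\hat N=\sum_{\mathbf p\in\Lambda^*_\ell}\hat n_{\mathbf p}$. Let $$\hat H^{\rm per}_\ell=\sum_{\mathbf p\in\Lambda_\ell^*}\lambda_\ell(\mathbf p)\,\hat n_{\mathbf p}+\frac{a}{V_\ell}\hat a_{\mathbf 0}^{\dagger 2}\hat a_{\mathbf 0}^{2}-2\nu\sqrt{V_\ell\,\hat n_{\mathbf 0}},\qquad \lambda_\ell(\mathbf 0)=\Delta,\quad \lambda_\ell(\mathbf p)=\tfrac12|\mathbf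 p|^2\ (\mathbf p\ne\mathbf 0),$$ and for $\beta>0$ let $\langle \hat A\rangle_{\beta,\mu,\ell}=\mathrm{Tr}_{\mathcal F_B}\big(\hat A\,e^{-\beta(\hat H^{\rm per}_\ell-\mu\hat N)}\big)\big/\,\mathrm{Tr}_{\mathcal F_B}\,e^{-\beta(\hat H^{\rm per}_\ell-\mu\hat N)}$ be the grand canonical average. Then the system undergoes non-conventional Bose–Einstein condensation, that is, a temperature-independent macroscopic occupation of the zero mode: there is a $\rho_{\mathbf 0}>0$ such that, for every $\beta>0$, the Gibbs state and the average of $\hat n_{\mathbf 0}/V_\ell$ are well defined for every $\ell>0$ and $$\lim_{\ell\to\infty}\Big\langle \frac{\hat n_{\mathbf 0}}{V_\ell}\Big\rangle_{\beta,\mu,\ell}=\rho_{\mathbf 0}.$$ Moreover, the equation $$z+\frac{\Delta-\mu}{2a}=\frac{\nu}{2a\sqrt z}$$ has exactly one solution $z_0=z_0(\mu,\nu,\Delta)>0$, and the density of the condensate is $\rho_{\mathbf 0}=z_0$ for every $\beta>0$. This holds in particular without a gap, $\Delta=0$. -/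

import Mathlib

open Filter Topology
open scoped InnerProductSpace

noncomputable section

namespace BoseGas

/-- Volume `V = ℓ³` of the cubic box of side `ℓ` in `ℝ³`. -/
def volumeBox (ℓ : ℝ) : ℝ := ℓ ^ 3

/-- The momenta `p` with `p_α = 2 π n_α / ℓ`, `n_α ∈ ℤ` (periodic boundary conditions). -/
def dualLattice (ℓ : ℝ) : Set (EuclideanSpace ℝ (Fin 3)) :=
  {p | ∀ α, ∃ n : ℤ, p α = 2 * Real.pi * n / ℓ}

/-- The one-particle modes (plane waves of the box), labelled by their momenta. -/
abbrev Mode (ℓ : ℝ) : Type := ↥(dualLattice ℓ)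

/-- The zero mode `p = 0`. -/
def zeroMode (ℓ : ℝ) : Mode ℓ := ⟨0, fun _ => ⟨0, by simp⟩⟩

/-- Occupation numbers: finitely many particles distributed over the modes. -/
abbrev Occupation (ℓ : ℝ) : Type := Mode ℓ →₀ ℕ

/-- The boson Fock space over `L²` of the box, in the occupation number representation with
respect to the orthonormal basis of plane waves: square summable families of amplitudes indexed
by the occupation numbers. -/
abbrev FockSpace (ℓ : ℝ) : Type := lp (fun _ : Occupation ℓ => ℂ) 2

open Classical in
/-- The number state `|n⟩`. -/
def numberState {ℓ : ℝ} (n : Occupation ℓ) : FockSpace ℓ := lp.single 2 n (1 : ℂ)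

open Classical in
theorem inner_numberState {ℓ : ℝ} (m n : Occupation ℓ) :
    ⟪numberState m, numberState n⟫_ℂ = if m = n then 1 else 0 := by
  unfold numberState
  rw [lp.inner_single_left]
  by_cases h : m = n
  · subst h; simp
  · simp [lp.single_apply, h]

theorem orthonormal_numberState {ℓ : ℝ} :
    Orthonormal ℂ (numberState : Occupation ℓ → FockSpace ℓ) := by
  classical
  rw [orthonormal_iff_ite]
  intro m n
  convert inner_numberState m n

/-- The dense subspace of finite linear combinations of number states.  It is the common
invariant core on which all operators below are given. -/
def FockCore (ℓ : ℝ) : Submodule ℂ (FockSpace ℓ) :=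
  Submodule.span ℂ (Set.range (numberState : Occupation ℓ → FockSpace ℓ))

/-- The number states, as a basis of the core. -/
def coreBasis (ℓ : ℝ) : Module.Basis (Occupation ℓ) ℂ (FockCore ℓ) :=
  Module.Basis.span orthonormal_numberState.linearIndependent

theorem coe_coreBasis {ℓ : ℝ} (n : Occupation ℓ) :
    (coreBasis ℓ n : FockSpace ℓ) = numberState n := by
  unfold coreBasis
  exact congrArg Subtype.val (Module.Basis.span_apply orthonormal_numberState.linearIndependent n)

theorem dense_fockCore (ℓ : ℝ) : Dense (FockCore ℓ : Set (FockSpace ℓ)) := by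
  classical
  intro ψ
  have h := lp.hasSum_single (E := fun _ : Occupation ℓ => ℂ) (p := 2) (by simp) ψ
  refine mem_closure_of_tendsto h (Eventually.of_forall fun s => ?_)
  refine Submodule.sum_mem _ fun n _ => ?_
  have hn : lp.single (E := fun _ : Occupation ℓ => ℂ) 2 n (ψ n) = (ψ n) • numberState n := by
    unfold numberState
    rw [← lp.single_smul]
    simp
  rw [hn]
  exact Submodule.smul_mem _ _ (Submodule.subset_span ⟨n, rfl⟩)

/-- Operators on Fock space, given on the core. -/
abbrev Op (ℓ : ℝ) : Type := Module.End ℂ (FockCore ℓ)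

/-- Creation operator: `a†_p |n⟩ = √(n_p + 1) |n + δ_p⟩`. -/
def create {ℓ : ℝ} (p : Mode ℓ) : Op ℓ :=
  (coreBasis ℓ).constr ℂ fun n =>
    (Real.sqrt (n p + 1) : ℂ) • coreBasis ℓ (n + Finsupp.single p 1)

/-- Annihilation operator: `a_p |n⟩ = √n_p |n - δ_p⟩` (which is `0` if `n_p = 0`). -/
def annihilate {ℓ : ℝ} (p : Mode ℓ) : Op ℓ :=
  (coreBasis ℓ).constr ℂ fun n =>
    (Real.sqrt (n p) : ℂ) • coreBasis ℓ (n - Finsupp.single p 1)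

/-- Number operator `n̂_p = a†_p a_p` of the mode `p`. -/
def numberOp {ℓ : ℝ} (p : Mode ℓ) : Op ℓ := create p * annihilate p

/-- The operator `∑_p c(p) n̂_p`; on `|n⟩` only the finitely many occupied modes contribute. -/
def modeSum {ℓ : ℝ} (c : Mode ℓ → ℝ) : Op ℓ :=
  (coreBasis ℓ).constr ℂ fun n =>
    ∑ p ∈ n.support, (c p : ℂ) • numberOp p (coreBasis ℓ n)

/-- Total number operator `N̂ = ∑_p n̂_p`. -/
def totalNumber (ℓ : ℝ) : Op ℓ := modeSum fun _ => 1

/-- The diagonal matrix element `⟨n| A |n⟩`. -/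
def diagElem {ℓ : ℝ} (A : Op ℓ) (n : Occupation ℓ) : ℂ :=
  ⟪numberState n, (A (coreBasis ℓ n) : FockSpace ℓ)⟫_ℂ

/-- The function `f(A)` of an operator `A` that is diagonal in the number states with real
eigenvalues (functional calculus): `f(A) |n⟩ = f(⟨n| A |n⟩) |n⟩`. -/
def diagFun {ℓ : ℝ} (f : ℝ → ℝ) (A : Op ℓ) : Op ℓ :=
  (coreBasis ℓ).constr ℂ fun n => (f (diagElem A n).re : ℂ) • coreBasis ℓ n

/-- One-particle energies: `Δ` for the zero mode, `p² / 2` for the others. -/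
def modeEnergy {ℓ : ℝ} (Δ : ℝ) (p : Mode ℓ) : ℝ :=
  open Classical in if p = zeroMode ℓ then Δ else ‖(p : EuclideanSpace ℝ (Fin 3))‖ ^ 2 / 2

/-- The free energy operator `∑_p λ(p) n̂_p`. -/
def freeHamiltonian (Δ ℓ : ℝ) : Op ℓ := modeSum (modeEnergy Δ)

/-- The perturbed energy operator
`∑_p λ(p) n̂_p + (a / V) (a†_0)² (a_0)² - 2 ν √(V n̂_0)`. -/
def perturbedHamiltonian (a ν Δ ℓ : ℝ) : Op ℓ :=
  freeHamiltonian Δ ℓ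
    + ((a / volumeBox ℓ : ℝ) : ℂ) • (create (zeroMode ℓ) ^ 2 * annihilate (zeroMode ℓ) ^ 2)
    - ((2 * ν : ℝ) : ℂ) •
        diagFun Real.sqrt ((volumeBox ℓ : ℂ) • numberOp (zeroMode ℓ))

/-- `H - μ N̂` for the perturbed energy operator `H`. -/
def grandHamiltonian (a ν Δ μ ℓ : ℝ) : Op ℓ :=
  perturbedHamiltonian a ν Δ ℓ - (μ : ℂ) • totalNumber ℓ

/-- The Gibbs operator `exp (-β (H - μ N̂))`. -/
def gibbsOp (a ν Δ μ β ℓ : ℝ) : Op ℓ :=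
  diagFun (fun E => Real.exp (-β * E)) (grandHamiltonian a ν Δ μ ℓ)

/-- The trace series converges (unconditionally) in the orthonormal basis of number states; for
a positive operator this says that it is of trace class. -/
def HasTrace {ℓ : ℝ} (A : Op ℓ) : Prop := Summable (diagElem A)

/-- The trace over Fock space. -/
def trace {ℓ : ℝ} (A : Op ℓ) : ℂ := ∑' n, diagElem A n

/-- The grand canonical average
`⟨A⟩ = (Tr exp (-β (H - μ N̂)))⁻¹ Tr (A exp (-β (H - μ N̂)))`. -/
def gibbsAverage (a ν Δ μ β ℓ : ℝ) (A : Op ℓ) : ℂ :=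
  (trace (gibbsOp a ν Δ μ β ℓ))⁻¹ * trace (A * gibbsOp a ν Δ μ β ℓ)

/-- The operator `ρ̂_0 = n̂_0 / V`, density of particles in the zero mode. -/
def zeroModeDensity (ℓ : ℝ) : Op ℓ := ((volumeBox ℓ)⁻¹ : ℂ) • numberOp (zeroMode ℓ)

/-- `ρ` is the density of the condensate at inverse temperature `β` and chemical potential `μ`:
the Gibbs state and the average of `n̂_0 / V` exist in every box, and this average tends to `ρ`
in the thermodynamic limit. -/
def HasCondensateDensity (a ν Δ μ β ρ : ℝ) : Prop :=
  (∀ ℓ : ℝ, 0 < ℓ → HasTrace (gibbsOp a ν Δ μ β ℓ) ∧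
    HasTrace (zeroModeDensity ℓ * gibbsOp a ν Δ μ β ℓ)) ∧
  Tendsto (fun ℓ : ℝ => gibbsAverage a ν Δ μ β ℓ (zeroModeDensity ℓ)) atTop (𝓝 (ρ : ℂ))

/-- Non-conventional Bose–Einstein condensation at chemical potential `μ`: macroscopic
occupation of the zero mode, with a density that does not depend on the temperature. -/
def UndergoesNCBEC (a ν Δ μ : ℝ) : Prop :=
  ∃ ρ : ℝ, 0 < ρ ∧ ∀ β : ℝ, 0 < β → HasCondensateDensity a ν Δ μ β ρ

/-! Sanity facts on the operators. -/

theorem create_basis {ℓ : ℝ} (p : Mode ℓ) (n : Occupation ℓ) :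
    create p (coreBasis ℓ n) =
      (Real.sqrt (n p + 1) : ℂ) • coreBasis ℓ (n + Finsupp.single p 1) :=
  Module.Basis.constr_basis _ _ _ _

theorem annihilate_basis {ℓ : ℝ} (p : Mode ℓ) (n : Occupation ℓ) :
    annihilate p (coreBasis ℓ n) =
      (Real.sqrt (n p) : ℂ) • coreBasis ℓ (n - Finsupp.single p 1) :=
  Module.Basis.constr_basis _ _ _ _

theorem diagElem_of_eigen {ℓ : ℝ} {A : Op ℓ} {n : Occupation ℓ} {E : ℂ}
    (h : A (coreBasis ℓ n) = E • coreBasis ℓ n) : diagElem A n = E := by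
  rw [diagElem, h, Submodule.coe_smul, coe_coreBasis, inner_smul_right, inner_numberState]
  simp

theorem numberOp_basis {ℓ : ℝ} (p : Mode ℓ) (n : Occupation ℓ) :
    numberOp p (coreBasis ℓ n) = (n p : ℂ) • coreBasis ℓ n := by
  rw [numberOp, Module.End.mul_apply, annihilate_basis, map_smul, create_basis, smul_smul]
  rcases Nat.eq_zero_or_pos (n p) with h | h
  · simp [h]
  · have h1 : n - Finsupp.single p 1 + Finsupp.single p 1 = n :=
      tsub_add_cancel_of_le (by simpa [Nat.one_le_iff_ne_zero, Nat.pos_iff_ne_zero] using h)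
    have h2 : (((n - Finsupp.single p 1 : Occupation ℓ) p : ℕ) : ℝ) + 1 = n p := by
      have : (n - Finsupp.single p 1 : Occupation ℓ) p = n p - 1 := by simp
      rw [this, Nat.cast_sub h]; simp
    rw [h1, h2, ← Complex.ofReal_mul, Real.mul_self_sqrt (by positivity)]
    simp

/-- The canonical commutation relation `[a_p, a†_p] = 1`. -/
theorem commutation {ℓ : ℝ} (p : Mode ℓ) :
    annihilate p * create p - create p * annihilate p = 1 := by
  refine (coreBasis ℓ).ext fun n => ?_
  have h := numberOp_basis p n
  rw [numberOp] at h
  rw [LinearMap.sub_apply, h, Module.End.mul_apply, create_basis, map_smul, annihilate_basis,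
    smul_smul]
  have h3 : ((n + Finsupp.single p 1 : Occupation ℓ) p : ℝ) = n p + 1 := by simp
  rw [h3, add_tsub_cancel_right, ← Complex.ofReal_mul, Real.mul_self_sqrt (by positivity)]
  rw [← sub_smul]
  simp

theorem modeSum_basis {ℓ : ℝ} (c : Mode ℓ → ℝ) (n : Occupation ℓ) :
    modeSum c (coreBasis ℓ n) = ((∑ p ∈ n.support, c p * n p : ℝ) : ℂ) • coreBasis ℓ n := by
  rw [modeSum, Module.Basis.constr_basis]
  simp_rw [numberOp_basis, smul_smul]
  rw [← Finset.sum_smul]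
  push_cast
  rfl

theorem diagFun_basis {ℓ : ℝ} (f : ℝ → ℝ) {A : Op ℓ} {n : Occupation ℓ} {E : ℝ}
    (h : A (coreBasis ℓ n) = (E : ℂ) • coreBasis ℓ n) :
    diagFun f A (coreBasis ℓ n) = (f E : ℂ) • coreBasis ℓ n := by
  rw [diagFun, Module.Basis.constr_basis, diagElem_of_eigen h, Complex.ofReal_re]

/-- The energy of the number state `|n⟩`. -/
theorem perturbedHamiltonian_basis (a ν Δ ℓ : ℝ) (n : Occupation ℓ) :
    perturbedHamiltonian a ν Δ ℓ (coreBasis ℓ n) =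
      ((∑ p ∈ n.support, modeEnergy Δ p * n p
        + a / volumeBox ℓ * (n (zeroMode ℓ) * (n (zeroMode ℓ) - 1))
        - 2 * ν * Real.sqrt (volumeBox ℓ * n (zeroMode ℓ)) : ℝ) : ℂ) • coreBasis ℓ n := by
  have hcc := commutation (zeroMode ℓ)
  have h4 : create (zeroMode ℓ) ^ 2 * annihilate (zeroMode ℓ) ^ 2 =
      numberOp (zeroMode ℓ) * numberOp (zeroMode ℓ) - numberOp (zeroMode ℓ) := by
    unfold numberOp
    have : annihilate (zeroMode ℓ) * create (zeroMode ℓ) =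
        1 + create (zeroMode ℓ) * annihilate (zeroMode ℓ) := by rw [← hcc]; abel
    calc _ = create (zeroMode ℓ) * (create (zeroMode ℓ) * annihilate (zeroMode ℓ)) *
          annihilate (zeroMode ℓ) := by noncomm_ring
      _ = create (zeroMode ℓ) * (annihilate (zeroMode ℓ) * create (zeroMode ℓ) - 1) *
          annihilate (zeroMode ℓ) := by rw [this]; abel_nf
      _ = _ := by
          rw [mul_sub, sub_mul, mul_one]
          simp only [mul_assoc]
  have h5 : ((volumeBox ℓ : ℂ) • numberOp (zeroMode ℓ)) (coreBasis ℓ n) =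
      ((volumeBox ℓ * n (zeroMode ℓ) : ℝ) : ℂ) • coreBasis ℓ n := by
    rw [LinearMap.smul_apply, numberOp_basis, smul_smul]; push_cast; rfl
  rw [perturbedHamiltonian, h4, LinearMap.sub_apply, LinearMap.add_apply, LinearMap.smul_apply,
    LinearMap.smul_apply, diagFun_basis _ h5, LinearMap.sub_apply, Module.End.mul_apply,
    numberOp_basis, map_smul, numberOp_basis, freeHamiltonian, modeSum_basis]
  push_cast
  module

end BoseGas

end

/-! ### Summability over integers and over occupation numbers -/

noncomputable section

/-! All operators involved are diagonal in the number states, and the energy is a function of the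
zero-mode occupation `k` plus a function of the other occupations. The excited factor of the Gibbs
weight is therefore summable by itself and cancels from the average (`hasTrace_and_gibbsAverage`),
leaving a one-dimensional average of `k / V`.

Laplace's method evaluates it. The equation for `z` says that the zero-mode energy density is
stationary at `z`; completing squares (`zeroModeEnergy_eq`) writes the energy as a constant plus `V`
times an excess of at least `a * (x - z) ^ 2`, where `x = k / V`, minus the bounded-slope term `a *
(x - z)`. Occupations with `x` farther than `δ` from `z` contribute O(1/V)
(`abs_sub_mul_relativeWeight_le`), while one term alone keeps the partition sum away from zero
(`exists_le_relativeWeight`). So the average tends to `z`. As `β` does not enter the equation for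
`z`, neither does it enter the limit. -/

theorem exists_uniform_bound_tsum_abs_sub_mul_exp {c : ℝ} (hc : 0 < c) :
    ∃ K : ℝ, ∀ s : ℝ, Summable (fun k : ℕ => |k - s| * Real.exp (-c * |k - s|)) ∧
      ∑' k : ℕ, |k - s| * Real.exp (-c * |k - s|) ≤ K := by
  -- Replacing `s` by `⌊s⌋` changes the distance to `k` by at most 1, which costs the `+ 1` and the
  -- factor `exp c`. The sum over all of `ℤ` is then translation invariant, hence a bound free of
  -- `s`.
  set F : ℤ → ℝ := fun j => (|(j : ℝ)| + 1) * (Real.exp c * Real.exp (-c * |(j : ℝ)|)) with hF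
  have hnat : Summable fun k : ℕ => ((k : ℝ) + 1) * (Real.exp c * Real.exp (-c * (k : ℝ))) := by
    have h1 := (Real.summable_pow_mul_exp_neg_nat_mul 1 hc).mul_left (Real.exp c)
    have h0 := (Real.summable_pow_mul_exp_neg_nat_mul 0 hc).mul_left (Real.exp c)
    refine (h1.add h0).congr fun k => ?_
    simp only [pow_one, pow_zero]
    ring
  have hFs : Summable F := by
    refine Summable.of_nat_of_neg ?_ ?_ <;>
    · refine hnat.congr fun k => ?_
      simp [hF]
  have hF0 : ∀ j, 0 ≤ F j := fun j => by positivity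
  refine ⟨∑' j, F j, fun s => ?_⟩
  have hinj : Function.Injective fun k : ℕ => (k : ℤ) - ⌊s⌋ := fun k l h => by
    simpa using h
  have hle : ∀ k : ℕ, |k - s| * Real.exp (-c * |k - s|) ≤ F ((k : ℤ) - ⌊s⌋) := fun k => by
    have h1 := Int.floor_le s
    have h2 := Int.lt_floor_add_one s
    simp only [hF]
    push_cast
    have hd : |(k - s : ℝ) - (k - ⌊s⌋)| ≤ 1 := by
      rw [abs_le]; constructor <;> linarith
    have h3 := abs_sub_abs_le_abs_sub (k - s : ℝ) (k - ⌊s⌋)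
    have h4 := abs_sub_abs_le_abs_sub (k - ⌊s⌋ : ℝ) (k - s)
    rw [abs_sub_comm (k - ⌊s⌋ : ℝ) (k - s)] at h4
    rw [← Real.exp_add]
    refine mul_le_mul (by linarith) (Real.exp_le_exp.2 ?_) (Real.exp_pos _).le (by positivity)
    nlinarith
  have hs : Summable fun k : ℕ => F ((k : ℤ) - ⌊s⌋) := hFs.comp_injective hinj
  have hs' := Summable.of_nonneg_of_le (fun k : ℕ => by positivity) hle hs
  exact ⟨hs', (hs'.tsum_le_tsum hle hs).trans
    (Summable.tsum_le_tsum_of_inj _ hinj (fun j _ => hF0 j) (fun _ => le_rfl) hs hFs)⟩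

theorem sum_finsupp_prod_pow {ι : Type*} (x : ι → ℝ) (s : Finset ι) (t : Finset ℕ) :
    ∑ n ∈ s.finsupp fun _ => t, (n.prod fun i k => x i ^ k) = ∏ i ∈ s, ∑ k ∈ t, x i ^ k := by
  classical
  rw [Finset.prod_sum]
  unfold Finset.finsupp
  rw [Finset.sum_map]
  refine Finset.sum_congr rfl fun f _ => ?_
  have hsupp := Finsupp.support_indicator_subset (s := s) (f := f)
  rw [Function.Embedding.coeFn_mk,
    Finsupp.prod_of_support_subset _ hsupp _ (fun i _ => pow_zero _), ← Finset.prod_attach]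
  refine Finset.prod_congr rfl fun i _ => ?_
  rw [Finsupp.indicator_of_mem i.2]

theorem Finset.exists_subset_finsupp {ι : Type*} (S : Finset (ι →₀ ℕ)) :
    ∃ (s : Finset ι) (N : ℕ), S ⊆ s.finsupp fun _ => Finset.range N := by
  classical
  refine ⟨S.sup Finsupp.support, S.sup (fun n => (S.sup Finsupp.support).sup n) + 1,
    fun n hn => ?_⟩
  refine Finset.mem_finsupp_iff.2 ⟨Finset.le_sup (f := Finsupp.support) hn,
    fun i hi => Finset.mem_range.2 (Nat.lt_succ_of_le ?_)⟩
  exact (Finset.le_sup (f := n) hi).trans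
    (Finset.le_sup (f := fun n : ι →₀ ℕ => (S.sup Finsupp.support).sup n) hn)

/-- Any finite set of occupations lies in a finite box, over which the sum is a product of truncated
geometric series. Each factor is at most `1 / (1 - x i) = 1 + x i / (1 - x i) ≤ exp (x i / (1 - x
i))`, and these exponents are summable. -/
theorem summable_finsupp_prod_pow {ι : Type*} {x : ι → ℝ} (h0 : ∀ i, 0 ≤ x i)
    (h1 : ∀ i, x i < 1) (hx : Summable x) :
    Summable fun n : ι →₀ ℕ => n.prod fun i k => x i ^ k := by
  have hy : Summable fun i => x i / (1 - x i) := by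
    refine Summable.of_norm_bounded_eventually (g := fun i => 2 * x i) (hx.mul_left 2) ?_
    have : ∀ᶠ i in cofinite, x i < 1 / 2 :=
      hx.tendsto_cofinite_zero.eventually (gt_mem_nhds (by norm_num))
    filter_upwards [this] with i hi
    have hp : 0 < 1 - x i := by linarith
    rw [Real.norm_of_nonneg (div_nonneg (h0 i) hp.le), div_le_iff₀ hp]
    nlinarith [h0 i]
  have hnn : ∀ n : ι →₀ ℕ, 0 ≤ n.prod fun i k => x i ^ k := fun n =>
    Finset.prod_nonneg fun i _ => pow_nonneg (h0 i) _
  refine summable_of_sum_le (c := Real.exp (∑' i, x i / (1 - x i))) hnn fun S => ?_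
  obtain ⟨s, N, hsub⟩ := Finset.exists_subset_finsupp S
  calc ∑ n ∈ S, (n.prod fun i k => x i ^ k)
      ≤ ∑ n ∈ s.finsupp fun _ => Finset.range N, (n.prod fun i k => x i ^ k) :=
        Finset.sum_le_sum_of_subset_of_nonneg hsub fun n _ _ => hnn n
    _ = ∏ i ∈ s, ∑ k ∈ Finset.range N, x i ^ k := sum_finsupp_prod_pow x s _
    _ ≤ ∏ i ∈ s, Real.exp (x i / (1 - x i)) := by
        refine Finset.prod_le_prod
          (fun i _ => Finset.sum_nonneg fun k _ => pow_nonneg (h0 i) _) fun i _ => ?_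
        have hp : 0 < 1 - x i := by linarith [h1 i]
        have h2 := (summable_geometric_of_lt_one (h0 i) (h1 i)).sum_le_tsum (Finset.range N)
          fun k _ => pow_nonneg (h0 i) _
        rw [tsum_geometric_of_lt_one (h0 i) (h1 i)] at h2
        refine h2.trans (le_trans (le_of_eq ?_) (Real.add_one_le_exp _))
        field_simp
        ring
    _ = Real.exp (∑ i ∈ s, x i / (1 - x i)) := (Real.exp_sum _ _).symm
    _ ≤ _ := Real.exp_le_exp.2 (hy.sum_le_tsum _ fun i _ =>
        div_nonneg (h0 i) (by linarith [h1 i]))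

theorem summable_exp_neg_mul_int_sq {c : ℝ} (hc : 0 < c) :
    Summable fun n : ℤ => Real.exp (-c * (n : ℝ) ^ 2) := by
  have h : Summable fun k : ℕ => Real.exp (-c * (k : ℝ) ^ 2) := by
    refine Summable.of_nonneg_of_le (fun _ => (Real.exp_pos _).le) (fun k => ?_)
      (by simpa using Real.summable_pow_mul_exp_neg_nat_mul 0 hc)
    refine Real.exp_le_exp.2 ?_
    have : (k : ℝ) ≤ (k : ℝ) ^ 2 := by
      exact_mod_cast Nat.le_self_pow two_ne_zero k
    nlinarith
  exact Summable.of_nat_of_neg (by simpa using h) (by simpa using h)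

namespace BoseGas

/-! ### Factorisation of the Gibbs weight and reduction to the zero mode -/

theorem summable_exp_neg_norm_sq {ℓ b : ℝ} (hℓ : 0 < ℓ) (hb : 0 < b) :
    Summable fun p : Mode ℓ => Real.exp (-b * ‖(p : EuclideanSpace ℝ (Fin 3))‖ ^ 2) := by
  choose N hN using fun p : Mode ℓ => p.2
  set c : ℝ := b * (2 * Real.pi / ℓ) ^ 2 with hc
  have h := summable_exp_neg_mul_int_sq (c := c) (by positivity)
  have hpos : 0 ≤ fun n : ℤ => Real.exp (-c * (n : ℝ) ^ 2) := fun _ => (Real.exp_pos _).le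
  have h2 := h.mul_of_nonneg h hpos hpos
  have h3 := h.mul_of_nonneg h2 hpos fun q => mul_nonneg (hpos q.1) (hpos q.2)
  have hinj : Function.Injective fun p : Mode ℓ => (N p 0, N p 1, N p 2) := fun p q hpq => by
    simp only [Prod.mk.injEq] at hpq
    ext α
    rw [hN p α, hN q α]
    fin_cases α <;> simp [hpq]
  refine (h3.comp_injective hinj).congr fun p => ?_
  simp only [Function.comp_apply, ← Real.exp_add]
  rw [EuclideanSpace.real_norm_sq_eq, Fin.sum_univ_three, hN p 0, hN p 1, hN p 2, hc]
  congr 1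
  ring

/-- Splitting an occupation into the occupation of the zero mode and the rest. -/
def splitZeroMode (ℓ : ℝ) :
    Occupation ℓ ≃ ℕ × {m : Occupation ℓ // m (zeroMode ℓ) = 0} where
  toFun n := (n (zeroMode ℓ), ⟨n.erase (zeroMode ℓ), Finsupp.erase_same⟩)
  invFun q := q.2.1 + Finsupp.single (zeroMode ℓ) q.1
  left_inv n := Finsupp.erase_add_single _ _
  right_inv := by
    rintro ⟨k, m, hm⟩
    refine Prod.ext (by simp [hm]) (Subtype.ext ?_)
    simp only [Finsupp.erase_add, Finsupp.erase_single, add_zero]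
    exact Finsupp.erase_of_notMem_support (by simpa using hm)

/-- The energy, chemical potential included, of `k` particles in the zero mode. -/
def zeroModeEnergy (a ν Δ μ V : ℝ) (k : ℕ) : ℝ :=
  (Δ - μ) * k + a / V * (k * (k - 1)) - 2 * ν * Real.sqrt (V * k)

theorem grandHamiltonian_splitZeroMode (a ν Δ μ ℓ : ℝ)
    (q : ℕ × {m : Occupation ℓ // m (zeroMode ℓ) = 0}) :
    grandHamiltonian a ν Δ μ ℓ (coreBasis ℓ ((splitZeroMode ℓ).symm q)) =
      ((zeroModeEnergy a ν Δ μ (volumeBox ℓ) q.1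
        + q.2.1.sum (fun p k => (modeEnergy Δ p - μ) * k) : ℝ) : ℂ) •
        coreBasis ℓ ((splitZeroMode ℓ).symm q) := by
  obtain ⟨k, m, hm⟩ := q
  set n := (splitZeroMode ℓ).symm (k, ⟨m, hm⟩) with hn
  have hn' : n = m + Finsupp.single (zeroMode ℓ) k := rfl
  have hk : n (zeroMode ℓ) = k := by simp [hn', hm]
  have hsum : n.sum (fun p k => (modeEnergy Δ p - μ) * (k : ℝ)) =
      m.sum (fun p k => (modeEnergy Δ p - μ) * (k : ℝ)) + (Δ - μ) * k := by
    rw [hn', Finsupp.sum_add_index' (by simp) (by intros; push_cast; ring),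
      Finsupp.sum_single_index (by simp)]
    simp [modeEnergy]
  have hsum' : n.sum (fun p k => (modeEnergy Δ p - μ) * (k : ℝ)) =
      ∑ p ∈ n.support, modeEnergy Δ p * n p - μ * ∑ p ∈ n.support, 1 * (n p : ℝ) := by
    rw [Finsupp.sum, Finset.mul_sum, ← Finset.sum_sub_distrib]
    exact Finset.sum_congr rfl fun _ _ => by ring
  rw [grandHamiltonian, LinearMap.sub_apply, LinearMap.smul_apply, perturbedHamiltonian_basis,
    totalNumber, modeSum_basis, smul_smul, ← sub_smul, hk, ← Complex.ofReal_mul,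
    ← Complex.ofReal_sub]
  congr 2
  simp only [zeroModeEnergy]
  linarith

/-- The Boltzmann weight of the particles outside the zero mode. -/
def excitedWeight (Δ μ β : ℝ) {ℓ : ℝ} (m : Occupation ℓ) : ℝ :=
  Real.exp (-β * m.sum fun p k => (modeEnergy Δ p - μ) * k)

theorem summable_excitedWeight {Δ μ β ℓ : ℝ} (hμ : μ ≤ 0) (hβ : 0 < β) (hℓ : 0 < ℓ) :
    Summable fun m : {m : Occupation ℓ // m (zeroMode ℓ) = 0} => excitedWeight Δ μ β m.1 := by
  classical
  -- The zero mode gets fugacity 0, since it is empty here and its true factor need not be below 1.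
  -- For the others `μ ≤ 0` and `p ≠ 0` force `x p < 1`.
  set x : Mode ℓ → ℝ := fun p =>
    if p = zeroMode ℓ then 0 else Real.exp (-β * (modeEnergy Δ p - μ)) with hx
  have hx0 : ∀ p, 0 ≤ x p := fun p => by
    simp only [hx]; split_ifs <;> positivity
  have hxle : ∀ p : Mode ℓ,
      x p ≤ Real.exp (-(β / 2) * ‖(p : EuclideanSpace ℝ (Fin 3))‖ ^ 2) := fun p => by
    simp only [hx]
    split_ifs with h
    · positivity
    · refine Real.exp_le_exp.2 ?_
      simp only [modeEnergy, if_neg h]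
      nlinarith
  have hx1 : ∀ p, x p < 1 := fun p => by
    by_cases h : p = zeroMode ℓ
    · simp [hx, h]
    · refine (hxle p).trans_lt (Real.exp_lt_one_iff.2 ?_)
      have : (p : EuclideanSpace ℝ (Fin 3)) ≠ 0 := fun h0 => h (Subtype.ext h0)
      have := norm_pos_iff.2 this
      nlinarith [mul_pos hβ (pow_pos this 2)]
  have hxs : Summable x :=
    Summable.of_nonneg_of_le hx0 hxle (summable_exp_neg_norm_sq hℓ (by positivity))
  refine ((summable_finsupp_prod_pow hx0 hx1 hxs).comp_injective
    (i := fun m : {m : Occupation ℓ // m (zeroMode ℓ) = 0} => m.1)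
    Subtype.val_injective).congr fun m => ?_
  simp only [Function.comp_apply, excitedWeight, Finsupp.prod, Finsupp.sum]
  rw [Finset.mul_sum, Real.exp_sum]
  refine Finset.prod_congr rfl fun p hp => ?_
  have hne : p ≠ zeroMode ℓ := fun h => by
    rw [Finsupp.mem_support_iff, h] at hp
    exact hp m.2
  simp only [hx, if_neg hne]
  rw [← Real.exp_nat_mul]
  congr 1
  ring

/-- The Boltzmann weight of `k` particles in the zero mode. -/
def zeroModeWeight (a ν Δ μ β V : ℝ) (k : ℕ) : ℝ :=
  Real.exp (-β * zeroModeEnergy a ν Δ μ V k)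

/-- The quadratic repulsion dominates the linear and square-root terms, whatever the sign of `Δ -
μ`. -/
theorem summable_mul_zeroModeWeight {a ν Δ μ β V : ℝ} (ha : 0 < a) (hν : 0 < ν) (hβ : 0 < β)
    (hV : 0 < V) :
    Summable (zeroModeWeight a ν Δ μ β V) ∧
      Summable fun k : ℕ => (k : ℝ) * zeroModeWeight a ν Δ μ β V k := by
  set B : ℝ := μ - Δ + a / V + 2 * ν * V with hB
  set A : ℝ := a / V with hA
  have hA0 : 0 < A := by positivity
  -- The first term is the maximum of `(β * B + 1) * k - β * A * k ^ 2`, the `+ 1` paying for the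
  -- decay `exp (-k)`; the second comes from `√(V * k) ≤ 1 + V * k`.
  set D : ℝ := (β * B + 1) ^ 2 / (4 * (β * A)) + 2 * ν * β with hD
  have hle : ∀ k : ℕ, zeroModeWeight a ν Δ μ β V k ≤ Real.exp D * Real.exp (-1 * k) := fun k => by
    rw [zeroModeWeight, ← Real.exp_add]
    refine Real.exp_le_exp.2 ?_
    have hs : Real.sqrt (V * k) ≤ 1 + V * k := by
      rw [Real.sqrt_le_left (by positivity)]
      nlinarith [mul_nonneg hV.le (Nat.cast_nonneg (α := ℝ) k)]
    have hq : (β * B + 1) * k - β * A * (k : ℝ) ^ 2 ≤ (β * B + 1) ^ 2 / (4 * (β * A)) := by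
      rw [le_div_iff₀ (by positivity)]
      nlinarith [sq_nonneg (2 * (β * A) * k - (β * B + 1))]
    have hs' := mul_le_mul_of_nonneg_left hs (by positivity : 0 ≤ β * (2 * ν))
    simp only [zeroModeEnergy, hD, ← hA]
    have : B = μ - Δ + A + 2 * ν * V := hB
    rw [this] at hq ⊢
    nlinarith
  have h0 : ∀ k, 0 ≤ zeroModeWeight a ν Δ μ β V k := fun k => (Real.exp_pos _).le
  have e0 := (Real.summable_pow_mul_exp_neg_nat_mul 0 one_pos).mul_left (Real.exp D)
  have e1 := (Real.summable_pow_mul_exp_neg_nat_mul 1 one_pos).mul_left (Real.exp D)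
  refine ⟨Summable.of_nonneg_of_le h0 hle (by simpa using e0),
    Summable.of_nonneg_of_le (fun k => mul_nonneg k.cast_nonneg (h0 k))
      (fun k => mul_le_mul_of_nonneg_left (hle k) k.cast_nonneg) (e1.congr fun k => ?_)⟩
  simp only [pow_one]
  ring

theorem diagElem_gibbsOp (a ν Δ μ β ℓ : ℝ)
    (q : ℕ × {m : Occupation ℓ // m (zeroMode ℓ) = 0}) :
    diagElem (gibbsOp a ν Δ μ β ℓ) ((splitZeroMode ℓ).symm q) =
      ((zeroModeWeight a ν Δ μ β (volumeBox ℓ) q.1 * excitedWeight Δ μ β q.2.1 : ℝ) : ℂ) := by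
  refine diagElem_of_eigen ?_
  rw [gibbsOp, diagFun_basis _ (grandHamiltonian_splitZeroMode a ν Δ μ ℓ q), mul_add,
    Real.exp_add]
  rfl

theorem diagElem_zeroModeDensity_mul_gibbsOp (a ν Δ μ β ℓ : ℝ)
    (q : ℕ × {m : Occupation ℓ // m (zeroMode ℓ) = 0}) :
    diagElem (zeroModeDensity ℓ * gibbsOp a ν Δ μ β ℓ) ((splitZeroMode ℓ).symm q) =
      (((volumeBox ℓ)⁻¹ * (q.1 * zeroModeWeight a ν Δ μ β (volumeBox ℓ) q.1) *
        excitedWeight Δ μ β q.2.1 : ℝ) : ℂ) := by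
  have hk : ((splitZeroMode ℓ).symm q) (zeroMode ℓ) = q.1 :=
    congrArg Prod.fst ((splitZeroMode ℓ).apply_symm_apply q)
  refine diagElem_of_eigen ?_
  rw [Module.End.mul_apply, gibbsOp,
    diagFun_basis _ (grandHamiltonian_splitZeroMode a ν Δ μ ℓ q), mul_add, Real.exp_add, map_smul,
    zeroModeDensity, LinearMap.smul_apply, numberOp_basis, hk, smul_smul, smul_smul]
  congr 1
  simp only [zeroModeWeight, excitedWeight]
  push_cast
  ring

theorem hasSum_diagElem_of_split {ℓ : ℝ} {A : Op ℓ} {f : ℕ → ℝ}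
    {g : {m : Occupation ℓ // m (zeroMode ℓ) = 0} → ℝ} (hf : Summable f) (hf0 : 0 ≤ f)
    (hg : Summable g) (hg0 : 0 ≤ g)
    (h : ∀ q, diagElem A ((splitZeroMode ℓ).symm q) = ((f q.1 * g q.2 : ℝ) : ℂ)) :
    HasSum (diagElem A) (((∑' k, f k) * ∑' m, g m : ℝ) : ℂ) := by
  rw [← (splitZeroMode ℓ).symm.hasSum_iff]
  have hs : Summable fun q : ℕ × {m : Occupation ℓ // m (zeroMode ℓ) = 0} => f q.1 * g q.2 :=
    hf.mul_of_nonneg hg hf0 hg0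
  have := hs.hasSum
  rw [← hf.tsum_mul_tsum hg hs] at this
  exact (Complex.hasSum_ofReal.2 this).congr_fun h

theorem hasTrace_and_gibbsAverage {a ν Δ μ β ℓ : ℝ} (ha : 0 < a) (hν : 0 < ν) (hμ : μ ≤ 0)
    (hβ : 0 < β) (hℓ : 0 < ℓ) :
    HasTrace (gibbsOp a ν Δ μ β ℓ) ∧ HasTrace (zeroModeDensity ℓ * gibbsOp a ν Δ μ β ℓ) ∧
      gibbsAverage a ν Δ μ β ℓ (zeroModeDensity ℓ) =
        (((∑' k : ℕ, (volumeBox ℓ)⁻¹ * (k * zeroModeWeight a ν Δ μ β (volumeBox ℓ) k)) /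
          ∑' k, zeroModeWeight a ν Δ μ β (volumeBox ℓ) k : ℝ) : ℂ) := by
  have hV : 0 < volumeBox ℓ := pow_pos hℓ 3
  have hw0 : ∀ k, 0 ≤ zeroModeWeight a ν Δ μ β (volumeBox ℓ) k := fun _ => (Real.exp_pos _).le
  obtain ⟨hw, hkw⟩ := summable_mul_zeroModeWeight (μ := μ) (Δ := Δ) ha hν hβ hV
  have hg := summable_excitedWeight (Δ := Δ) hμ hβ hℓ
  have hg0 : 0 ≤ fun m : {m : Occupation ℓ // m (zeroMode ℓ) = 0} =>
    excitedWeight Δ μ β m.1 := fun _ => (Real.exp_pos _).le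
  have h1 := hasSum_diagElem_of_split hw hw0 hg hg0 (diagElem_gibbsOp a ν Δ μ β ℓ)
  have h2 := hasSum_diagElem_of_split (hkw.mul_left (volumeBox ℓ)⁻¹)
    (fun k => mul_nonneg (inv_nonneg.2 hV.le) (mul_nonneg k.cast_nonneg (hw0 k))) hg hg0
    (diagElem_zeroModeDensity_mul_gibbsOp a ν Δ μ β ℓ)
  refine ⟨h1.summable, h2.summable, ?_⟩
  have hgpos : 0 < ∑' m : {m : Occupation ℓ // m (zeroMode ℓ) = 0}, excitedWeight Δ μ β m.1 :=
    hg.tsum_pos hg0 ⟨0, rfl⟩ (Real.exp_pos _)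
  rw [gibbsAverage, trace, trace, h1.tsum_eq, h2.tsum_eq, ← Complex.ofReal_inv,
    ← Complex.ofReal_mul]
  congr 1
  rw [inv_mul_eq_div, mul_div_mul_right _ _ hgpos.ne']

/-! ### Energy near the stationary density -/

/-- The excess energy density of the zero mode at density `x`, relative to density `z`. -/
def excessEnergy (a ν z x : ℝ) : ℝ :=
  a * (x - z) ^ 2 + ν / Real.sqrt z * (Real.sqrt x - Real.sqrt z) ^ 2

theorem zeroModeEnergy_eq {a ν Δ μ V z : ℝ} (ha : 0 < a) (hV : 0 < V) (hz : 0 < z)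
    (h : z + (Δ - μ) / (2 * a) = ν / (2 * a * Real.sqrt z)) (k : ℕ) :
    zeroModeEnergy a ν Δ μ V k =
      V * ((Δ - μ) * z + a * z ^ 2 - 2 * ν * Real.sqrt z) - a * z +
        (V * excessEnergy a ν z (k / V) - a * (k / V - z)) := by
  have hs : 0 < Real.sqrt z := Real.sqrt_pos.2 hz
  have hzz : z = Real.sqrt z ^ 2 := (Real.sq_sqrt hz.le).symm
  set x : ℝ := k / V with hx
  have hx0 : 0 ≤ x := by positivity
  have hk : (k : ℝ) = V * x := by rw [hx]; field_simp
  have hr : Real.sqrt (V * k) = V * Real.sqrt x := by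
    rw [hk, ← mul_assoc, Real.sqrt_mul (by positivity), Real.sqrt_mul_self hV.le]
  have hxx : x = Real.sqrt x ^ 2 := (Real.sq_sqrt hx0).symm
  -- Stationarity eliminates `Δ - μ`; what remains is a polynomial identity in `√x` and `√z`.
  have hΔ : Δ - μ = ν / Real.sqrt z - 2 * a * z := by
    field_simp at h ⊢
    linarith
  rw [zeroModeEnergy, hr, hk, hΔ, excessEnergy]
  generalize Real.sqrt x = r at *
  generalize Real.sqrt z = s at *
  subst hzz
  rw [hxx]
  field_simp
  ring

theorem le_excessEnergy {a ν z x : ℝ} (hν : 0 < ν) :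
    a * (x - z) ^ 2 ≤ excessEnergy a ν z x :=
  le_add_of_nonneg_right (by positivity)

theorem excessEnergy_le {a ν z x : ℝ} (hν : 0 < ν) (hz : 0 < z) (hx : 0 ≤ x) :
    excessEnergy a ν z x ≤ (a + ν / (Real.sqrt z * z)) * (x - z) ^ 2 := by
  have hs : 0 < Real.sqrt z := Real.sqrt_pos.2 hz
  have h : (Real.sqrt x - Real.sqrt z) ^ 2 ≤ (x - z) ^ 2 / z := by
    rw [le_div_iff₀ hz]
    have hf : x - z = (Real.sqrt x - Real.sqrt z) * (Real.sqrt x + Real.sqrt z) := by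
      nlinarith [Real.sq_sqrt hx, Real.sq_sqrt hz.le]
    rw [hf, mul_pow]
    refine mul_le_mul_of_nonneg_left ?_ (sq_nonneg _)
    nlinarith [Real.sq_sqrt hz.le, Real.sqrt_nonneg x]
  have := mul_le_mul_of_nonneg_left h (by positivity : 0 ≤ ν / Real.sqrt z)
  calc excessEnergy a ν z x
      ≤ a * (x - z) ^ 2 + ν / Real.sqrt z * ((x - z) ^ 2 / z) := by
        unfold excessEnergy; gcongr
    _ = _ := by field_simp

/-- With `s = √z` the equation is the cubic `2 * a * s ^ 3 + c * s = ν`, solved by the intermediate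
value theorem. For uniqueness, the left side of the original equation increases strictly in `z` and
the right side does not increase. -/
theorem existsUnique_density {a c ν : ℝ} (ha : 0 < a) (hν : 0 < ν) :
    ∃ z₀ : ℝ, (0 < z₀ ∧ z₀ + c / (2 * a) = ν / (2 * a * Real.sqrt z₀)) ∧
      ∀ z : ℝ, 0 < z → z + c / (2 * a) = ν / (2 * a * Real.sqrt z) → z = z₀ := by
  set S : ℝ := 1 + (|c| + ν) / (2 * a) with hS
  have hS1 : 1 ≤ S := le_add_of_nonneg_right (by positivity)
  have hcont : ContinuousOn (fun s : ℝ => 2 * a * s ^ 3 + c * s - ν) (Set.Icc 0 S) := by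
    fun_prop
  have hSv : 0 ≤ 2 * a * S ^ 3 + c * S - ν := by
    have h1 : 2 * a * S = 2 * a + |c| + ν := by rw [hS]; field_simp; ring
    have h2 : 2 * a * S ^ 3 + c * S - ν = (2 * a + |c| + ν) * S ^ 2 + c * S - ν := by
      rw [← h1]; ring
    rw [h2]
    nlinarith [neg_abs_le c, abs_nonneg c, mul_nonneg (abs_nonneg c) (sub_nonneg.2 hS1),
      mul_nonneg hν.le (sub_nonneg.2 hS1), sq_nonneg S,
      mul_nonneg (mul_nonneg (abs_nonneg c) (sub_nonneg.2 hS1)) (zero_le_one.trans hS1),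
      mul_le_mul_of_nonneg_right (neg_abs_le c) (zero_le_one.trans hS1)]
  obtain ⟨s, ⟨hs0, -⟩, hs⟩ := intermediate_value_Icc (zero_le_one.trans hS1) hcont
    (show (0 : ℝ) ∈ Set.Icc _ _ from ⟨by simpa using hν.le, hSv⟩)
  have hspos : 0 < s := hs0.lt_of_ne' fun h => by
    simp only [h] at hs
    norm_num at hs
    exact hν.ne' hs
  have heq : s ^ 2 + c / (2 * a) = ν / (2 * a * Real.sqrt (s ^ 2)) := by
    rw [Real.sqrt_sq hs0]
    field_simp
    simp only at hs
    linarith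
  have hmono : ∀ y z : ℝ, 0 < y → y < z → y + c / (2 * a) = ν / (2 * a * Real.sqrt y) →
      z + c / (2 * a) ≠ ν / (2 * a * Real.sqrt z) := fun y z hy hyz h1 h2 => by
    have hsy := Real.sqrt_pos.2 hy
    have : ν / (2 * a * Real.sqrt z) ≤ ν / (2 * a * Real.sqrt y) := by
      have := Real.sqrt_le_sqrt hyz.le
      gcongr
    linarith
  refine ⟨s ^ 2, ⟨by positivity, heq⟩, fun z hz h => ?_⟩
  rcases lt_trichotomy z (s ^ 2) with hlt | he | hgt
  · exact absurd heq (hmono _ _ hz hlt h)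
  · exact he
  · exact absurd h (hmono _ _ (by positivity) hgt heq)

/-! ### Concentration and the thermodynamic limit -/

/-- The Boltzmann weight of `k` particles in the zero mode, up to a factor independent of `k`. -/
def relativeWeight (a ν z β V : ℝ) (k : ℕ) : ℝ :=
  Real.exp (-β * (V * excessEnergy a ν z (k / V) - a * (k / V - z)))

theorem abs_sub_mul_relativeWeight_le {a ν z β V δ : ℝ} (ha : 0 < a) (hν : 0 < ν) (hβ : 0 < β)
    (hδ : 0 < δ) (hV : 2 / δ ≤ V) (k : ℕ) :
    |k / V - z| * relativeWeight a ν z β V k ≤ δ * relativeWeight a ν z β V k +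
      V⁻¹ * (|k - V * z| * Real.exp (-(β * a * δ / 2) * |k - V * z|)) := by
  have hV0 : 0 < V := lt_of_lt_of_le (by positivity) hV
  have hw : 0 < relativeWeight a ν z β V k := Real.exp_pos _
  by_cases hy : |k / V - z| ≤ δ
  · exact (mul_le_mul_of_nonneg_right hy hw.le).trans (le_add_of_nonneg_right (by positivity))
  · push Not at hy
    have ht : |k - V * z| = V * |k / V - z| := by
      rw [← abs_of_pos hV0, ← abs_mul, abs_of_pos hV0, mul_sub, mul_div_cancel₀ _ hV0.ne']
    have hle : relativeWeight a ν z β V k ≤ Real.exp (-(β * a * δ / 2) * |k - V * z|) := by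
      refine Real.exp_le_exp.2 ?_
      have h1 : a * |k / V - z| ^ 2 ≤ excessEnergy a ν z (k / V) := by
        rw [sq_abs]; exact le_excessEnergy hν
      have h2 := le_abs_self (k / V - z)
      rw [ht]
      generalize |k / V - z| = y at *
      have h3 : 2 ≤ V * δ := (div_le_iff₀ hδ).1 hV
      -- Since `V * y > V * δ ≥ 2`, half of `V * δ` absorbs the linear correction and the other half
      -- gives the exponential rate.
      have h4 : a * δ / 2 * (V * y) ≤ V * (a * y ^ 2) - a * y := by
        have hy0 : 0 < y := hδ.trans hy
        have h5 : V * δ ≤ V * y := mul_le_mul_of_nonneg_left hy.le hV0.le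
        have h6 : 0 ≤ a * y * (V * y - 1 - V * δ / 2) :=
          mul_nonneg (by positivity) (by linarith)
        linarith
      have h7 := mul_le_mul_of_nonneg_left h1 hV0.le
      have h8 := mul_le_mul_of_nonneg_left h2 ha.le
      have h9 := mul_le_mul_of_nonneg_left
        (by linarith : a * δ / 2 * (V * y) ≤
          V * excessEnergy a ν z (k / V) - a * (k / V - z)) hβ.le
      linarith
    have h := mul_le_mul_of_nonneg_left hle (abs_nonneg (k / V - z))
    rw [ht, ← mul_assoc V⁻¹, inv_mul_cancel_left₀ hV0.ne', ← ht]
    exact h.trans (le_add_of_nonneg_left (by positivity))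

theorem exists_le_relativeWeight {a ν z β V : ℝ} (ha : 0 < a) (hν : 0 < ν) (hβ : 0 < β)
    (hz : 0 < z) (hV : 1 ≤ V) :
    ∃ k, Real.exp (-β * (a + ν / (Real.sqrt z * z))) ≤ relativeWeight a ν z β V k := by
  have hV0 : 0 < V := zero_lt_one.trans_le hV
  -- Rounding up makes `k / V - z` nonnegative, so the linear term only raises the weight, while the
  -- excess stays O(1/V).
  refine ⟨⌈V * z⌉₊, Real.exp_le_exp.2 ?_⟩
  have h1 := Nat.le_ceil (V * z)
  have h2 := (Nat.ceil_lt_add_one (by positivity : 0 ≤ V * z)).le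
  generalize (⌈V * z⌉₊ : ℝ) = t at *
  have hy0 : 0 ≤ t / V - z := by
    rw [sub_nonneg, le_div_iff₀ hV0]; linarith
  have hy1 : V * (t / V - z) ≤ 1 := by
    rw [mul_sub, mul_div_cancel₀ _ hV0.ne']; linarith
  have h3 := excessEnergy_le (a := a) hν hz (by linarith : 0 ≤ t / V)
  generalize hC : a + ν / (Real.sqrt z * z) = C at *
  have hC0 : 0 < C := by rw [← hC]; positivity
  have hsq : V * (t / V - z) ^ 2 ≤ 1 := by nlinarith
  have h4 : V * excessEnergy a ν z (t / V) ≤ C := by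
    nlinarith [mul_le_mul_of_nonneg_left h3 hV0.le, mul_le_mul_of_nonneg_left hsq hC0.le]
  have h5 := mul_nonneg ha.le hy0
  nlinarith

theorem tendsto_zeroMode_average {a ν Δ μ β z : ℝ} (ha : 0 < a) (hν : 0 < ν) (hβ : 0 < β)
    (hz : 0 < z) (h : z + (Δ - μ) / (2 * a) = ν / (2 * a * Real.sqrt z)) :
    Tendsto (fun V : ℝ => (∑' k : ℕ, V⁻¹ * (k * zeroModeWeight a ν Δ μ β V k)) /
      ∑' k, zeroModeWeight a ν Δ μ β V k) atTop (𝓝 z) := by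
  rw [Metric.tendsto_atTop]
  intro ε hε
  obtain ⟨K, hK⟩ := exists_uniform_bound_tsum_abs_sub_mul_exp
    (c := β * a * (ε / 2) / 2) (by positivity)
  have hK0 : 0 ≤ K := (tsum_nonneg fun k => by positivity).trans (hK 0).2
  set e : ℝ := Real.exp (-β * (a + ν / (Real.sqrt z * z))) with he
  have he0 : 0 < e := Real.exp_pos _
  -- The three thresholds serve the lower bound `e`, the tail estimate with `δ = ε / 2`, and `K / V
  -- < e * (ε / 2)`.
  refine ⟨max (max 1 (2 / (ε / 2))) (K / (e * (ε / 2)) + 1), fun V hV => ?_⟩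
  have hV1 : 1 ≤ V := (le_max_left _ _).trans ((le_max_left _ _).trans hV)
  have hV2 : 2 / (ε / 2) ≤ V := (le_max_right _ _).trans ((le_max_left _ _).trans hV)
  have hV3 : K / (e * (ε / 2)) < V := (lt_add_one _).trans_le ((le_max_right _ _).trans hV)
  have hV0 : 0 < V := zero_lt_one.trans_le hV1
  obtain ⟨hw, hkw⟩ := summable_mul_zeroModeWeight (μ := μ) (Δ := Δ) ha hν hβ hV0
  set u := relativeWeight a ν z β V with hu
  have hu0 : ∀ k, 0 < u k := fun _ => Real.exp_pos _
  set M : ℝ := Real.exp (-β * (V * ((Δ - μ) * z + a * z ^ 2 - 2 * ν * Real.sqrt z) - a * z))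
    with hM
  have hM0 : 0 < M := Real.exp_pos _
  have hwu : zeroModeWeight a ν Δ μ β V = fun k => M * u k := by
    funext k
    rw [zeroModeWeight, zeroModeEnergy_eq ha hV0 hz h, mul_add, Real.exp_add]
    rfl
  have hus : Summable u := (summable_mul_left_iff hM0.ne').1 (hwu ▸ hw)
  have hkus : Summable fun k : ℕ => (k : ℝ) * u k := by
    refine (summable_mul_left_iff hM0.ne').1 (hkw.congr fun k => ?_)
    rw [hwu]; ring
  have hus0 : 0 < ∑' k, u k := hus.tsum_pos (fun k => (hu0 k).le) 0 (hu0 0)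
  have hlow : e ≤ ∑' k, u k := by
    obtain ⟨k, hk⟩ := exists_le_relativeWeight ha hν hβ hz hV1
    exact hk.trans (hus.le_tsum k fun j _ => (hu0 j).le)
  have hnum : ∑' k : ℕ, V⁻¹ * (k * zeroModeWeight a ν Δ μ β V k) =
      M * ∑' k : ℕ, (k / V) * u k := by
    rw [← tsum_mul_left]
    refine tsum_congr fun k => ?_
    rw [hwu]; ring
  have hxs : Summable fun k : ℕ => (k / V) * u k :=
    (hkus.mul_left V⁻¹).congr fun k => by ring
  have hys : Summable fun k : ℕ => (k / V - z) * u k :=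
    (hxs.sub (hus.mul_left z)).congr fun k => by ring
  have hyt : ∑' k : ℕ, (k / V - z) * u k = ∑' k : ℕ, (k / V) * u k - z * ∑' k, u k := by
    rw [← tsum_mul_left, ← hxs.tsum_sub (hus.mul_left z)]
    exact tsum_congr fun k => by ring
  have habs : ∀ k : ℕ, |(k / V - z) * u k| = |k / V - z| * u k := fun k => by
    rw [abs_mul, abs_of_pos (hu0 k)]
  have hbound : |∑' k : ℕ, (k / V - z) * u k| ≤ ε / 2 * ∑' k, u k + V⁻¹ * K := by
    obtain ⟨hs, hsK⟩ := hK (V * z)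
    have hsum := (hus.mul_left (ε / 2)).add (hs.mul_left V⁻¹)
    calc |∑' k : ℕ, (k / V - z) * u k| ≤ ∑' k : ℕ, |(k / V - z) * u k| := by
          simpa only [Real.norm_eq_abs] using norm_tsum_le_tsum_norm hys.norm
      _ ≤ ∑' k : ℕ, (ε / 2 * u k + V⁻¹ * (|k - V * z| *
            Real.exp (-(β * a * (ε / 2) / 2) * |k - V * z|))) :=
          hys.abs.tsum_le_tsum (fun k => (habs k).le.trans
            (abs_sub_mul_relativeWeight_le ha hν hβ (by positivity) hV2 k)) hsum
      _ = ε / 2 * ∑' k, u k + V⁻¹ * ∑' k : ℕ, |k - V * z| *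
            Real.exp (-(β * a * (ε / 2) / 2) * |k - V * z|) := by
          rw [(hus.mul_left _).tsum_add (hs.mul_left _), tsum_mul_left, tsum_mul_left]
      _ ≤ _ := by gcongr
  have hsmall : V⁻¹ * K < ε / 2 * ∑' k, u k := by
    refine lt_of_lt_of_le ?_ (mul_le_mul_of_nonneg_left hlow (by positivity))
    rw [div_lt_iff₀ (by positivity)] at hV3
    rw [inv_mul_lt_iff₀ hV0]
    linarith
  rw [hnum, hwu, tsum_mul_left, mul_div_mul_left _ _ hM0.ne', Real.dist_eq]
  have : (∑' k : ℕ, (k / V) * u k) / ∑' k, u k - z =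
      (∑' k : ℕ, (k / V - z) * u k) / ∑' k, u k := by
    rw [hyt]; field_simp
  rw [this, abs_div, abs_of_pos hus0, div_lt_iff₀ hus0]
  linarith

theorem hasCondensateDensity {a ν Δ μ β z : ℝ} (ha : 0 < a) (hν : 0 < ν) (hμ : μ ≤ 0)
    (hβ : 0 < β) (hz : 0 < z) (h : z + (Δ - μ) / (2 * a) = ν / (2 * a * Real.sqrt z)) :
    HasCondensateDensity a ν Δ μ β z := by
  refine ⟨fun ℓ hℓ => ?_, ?_⟩
  · obtain ⟨h1, h2, -⟩ := hasTrace_and_gibbsAverage (Δ := Δ) ha hν hμ hβ hℓ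
    exact ⟨h1, h2⟩
  · have hV : Tendsto volumeBox atTop atTop := tendsto_pow_atTop three_ne_zero
    refine Tendsto.congr' ?_ ((Complex.continuous_ofReal.tendsto z).comp
      ((tendsto_zeroMode_average ha hν hβ hz h).comp hV))
    filter_upwards [eventually_gt_atTop 0] with ℓ hℓ
    exact (hasTrace_and_gibbsAverage ha hν hμ hβ hℓ).2.2.symm

end BoseGas

end

/-- Condensation for the gas perturbed by the square root of the zero mode number operator. -/
theorem corollary2 (a μ ν Δ : ℝ) (ha : 0 < a) (hμ : μ ≤ 0) (hν : 0 < ν) (hΔ : Δ ≤ 0) :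
    BoseGas.UndergoesNCBEC a ν Δ μ ∧
    ∃ z₀ : ℝ,
      (0 < z₀ ∧ z₀ + (Δ - μ) / (2 * a) = ν / (2 * a * Real.sqrt z₀)) ∧
      (∀ z : ℝ, 0 < z → z + (Δ - μ) / (2 * a) = ν / (2 * a * Real.sqrt z) → z = z₀) ∧
      ∀ β : ℝ, 0 < β → BoseGas.HasCondensateDensity a ν Δ μ β z₀ := by
  obtain ⟨z₀, ⟨hz, heq⟩, huniq⟩ := BoseGas.existsUnique_density (c := Δ - μ) ha hν
  have hdens : ∀ β : ℝ, 0 < β → BoseGas.HasCondensateDensity a ν Δ μ β z₀ :=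
    fun β hβ => BoseGas.hasCondensateDensity ha hν hμ hβ hz heq
  exact ⟨⟨z₀, hz, hdens⟩, z₀, ⟨hz, heq⟩, huniq, hdens⟩
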